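/- Let $G$ be a group with a homomorphism $s\colon G\to\{1,-1\}$; $g\in G$ is called unitary if $s(g)=1$ and anti-unitary if $s(g)=-1$. Put $V=\mathbb C^d$ with its standard Hermitian inner product, and let $\kappa_{1}=\mathrm{id}_V$ and $\kappa_{-1}=\kappa$, the entrywise complex conjugation. Let $\omega\colon G\times G\to U(1)$ be a factor system, that is, $\omega(g_1,g_2)\,\omega(g_1g_2,g_3)=\omega(g_2,g_3)^{s(g_1)}\,\omega(g_1,g_2g_3)$ for all $g_1,g_2,g_3\in G$. Let $M$ be a $d$-dimensional unitary projective co-representation of $G$ with factor system $\omega$: each $M(g)$, $g\in G$, is a unitary $d\times d$ matrix, and $$M(g_1)\kappa_{s(g_1)}\,M(g_2)\kappa_{s(g_2)}=\omega(g_1,g_2)\,M(g_1g_2)\kappa_{s(g_1g_2)}\qquad(g_1,g_2\in G).$$ A complex subspace of $V$ is invariant if every operator $M(g)\kappa_{s(g)}$ maps it into itself, and it is an irreducible component if it is nonzero, invariant, and contains no invariant complex subspace other than $0$ and itself. Let $\mathscr Q$ be the real vector space of all Hermitian $d\times d$ matrices that commute, as operators on $V$, with every $M(g)\kappa_{s(g)}$,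 and let $Q_1,\dots,Q_m$ be a basis of $\mathscr Q$ over $\mathbb R$. Let $r_1,\dots,r_m$ be real random variables on a probability space whose joint law is absolutely continuous with respect to Lebesgue measure on $\mathbb R^m$, and let $$Q_r=\sum_{l=1}^m r_l\,Q_l .$$ **Theorem.** Almost surely, the eigenspaces of $Q_r$ are irreducible components, they are pairwise orthogonal, and $V$ is their direct sum. Moreover, almost surely, the orthogonal projectors onto the eigenspaces of $Q_r$ (one for each distinct eigenvalue) commute with every $M(g)\kappa_{s(g)}$, have pairwise products $0$, and add up to the identity. -/

import Mathlib

open MeasureTheory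

noncomputable section

namespace Corep

/-- The carrier space `ℂ^d` with its standard Hermitian inner product. -/
abbrev Carrier (d : ℕ) : Type := EuclideanSpace ℂ (Fin d)

/-- Entrywise complex conjugation on `ℂ^d`; it is antilinear, hence only real-linear. -/
def conjugation (d : ℕ) : Carrier d →ₗ[ℝ] Carrier d where
  toFun v := WithLp.toLp 2 fun i => star (v i)
  map_add' v w := by
    ext i
    simp
  map_smul' c v := by
    ext i
    simp

/-- `κ_ε`: the identity for the sign `ε = 1`, complex conjugation for the sign `ε = -1`. -/
def kappa (d : ℕ) (ε : ℤˣ) : Carrier d →ₗ[ℝ] Carrier d :=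
  if ε = 1 then LinearMap.id else conjugation d

/-- The real-linear operator on `ℂ^d` defined by a complex matrix. -/
def matOp {d : ℕ} (A : Matrix (Fin d) (Fin d) ℂ) : Carrier d →ₗ[ℝ] Carrier d :=
  (Matrix.toEuclideanLin A).restrictScalars ℝ

variable {G : Type*} [Group G]

/-- A `U(1)`-valued factor system of a group `G` whose elements are marked as unitary
(`s g = 1`) or anti-unitary (`s g = -1`) by a homomorphism `s`. -/
structure FactorSystem (s : G →* ℤˣ) where
  /-- the factors `ω(g₁, g₂)` -/
  ω : G → G → Circle
  cocycle : ∀ g₁ g₂ g₃ : G,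
    ω g₁ g₂ * ω (g₁ * g₂) g₃ = ω g₂ g₃ ^ ((s g₁ : ℤˣ) : ℤ) * ω g₁ (g₂ * g₃)

/-- A `d`-dimensional unitary projective co-representation with factor system `ω`: unitary
matrices `M(g)` with `M(g₁)κ_{s(g₁)} M(g₂)κ_{s(g₂)} = ω(g₁, g₂) M(g₁g₂)κ_{s(g₁g₂)}`. -/
structure ProjCorep (s : G →* ℤˣ) (ω : FactorSystem s) (d : ℕ) where
  /-- the matrices `M(g)` -/
  M : G → Matrix.unitaryGroup (Fin d) ℂ
  mul_rel : ∀ (g₁ g₂ : G) (v : Carrier d),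
    matOp (M g₁).1 (kappa d (s g₁) (matOp (M g₂).1 (kappa d (s g₂) v))) =
      (ω.ω g₁ g₂ : ℂ) • matOp (M (g₁ * g₂)).1 (kappa d (s (g₁ * g₂)) v)

namespace ProjCorep

variable {s : G →* ℤˣ} {ω : FactorSystem s} {d : ℕ}

/-- The operator `M(g)κ_{s(g)}` on the carrier space. -/
def op (R : ProjCorep s ω d) (g : G) : Carrier d →ₗ[ℝ] Carrier d :=
  matOp (R.M g).1 ∘ₗ kappa d (s g)

/-- The real vector space of all Hermitian matrices that commute with every `M(g)κ_{s(g)}`. -/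
def hermitianCentralizer (R : ProjCorep s ω d) : Submodule ℝ (Matrix (Fin d) (Fin d) ℂ) where
  carrier := {Q | Q.IsHermitian ∧ ∀ g, matOp Q ∘ₗ R.op g = R.op g ∘ₗ matOp Q}
  zero_mem' := by
    refine ⟨Matrix.isHermitian_zero, fun g => ?_⟩
    ext1 v
    simp [matOp]
  add_mem' := by
    rintro A B ⟨hA, hA'⟩ ⟨hB, hB'⟩
    refine ⟨hA.add hB, fun g => ?_⟩
    have h : matOp (A + B) = matOp A + matOp B := by
      ext1 v
      simp [matOp]
    rw [h, LinearMap.add_comp, LinearMap.comp_add, hA', hB']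
  smul_mem' := by
    rintro c A ⟨hA, hA'⟩
    refine ⟨?_, fun g => ?_⟩
    · simp [Matrix.IsHermitian, Matrix.conjTranspose_smul, hA.eq]
    · have h : matOp (c • A) = c • matOp A := by
        have hc : c • A = (c : ℂ) • A := by
          ext i j
          simp
        ext1 v
        have e := congrArg (fun f => f v) (map_smul Matrix.toEuclideanLin (c : ℂ) A)
        rw [← hc] at e
        simpa [matOp] using e
      rw [h, LinearMap.smul_comp, LinearMap.comp_smul, hA']

/-- A complex subspace is invariant if every `M(g)κ_{s(g)}` maps it into itself. -/
def IsInvariant (R : ProjCorep s ω d) (W : Submodule ℂ (Carrier d)) : Prop :=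
  ∀ g, ∀ v ∈ W, R.op g v ∈ W

/-- A complex subspace is an irreducible component if it is nonzero, invariant, and has no
invariant complex subspaces other than `0` and itself. -/
def IsIrreducibleComponent (R : ProjCorep s ω d) (W : Submodule ℂ (Carrier d)) : Prop :=
  W ≠ ⊥ ∧ R.IsInvariant W ∧
    ∀ U : Submodule ℂ (Carrier d), U ≤ W → R.IsInvariant U → U = ⊥ ∨ U = W

end ProjCorep

/-- The type of eigenvalues of a complex matrix. -/
abbrev Eigenvalue {d : ℕ} (A : Matrix (Fin d) (Fin d) ℂ) : Type :=
  Module.End.Eigenvalues (Matrix.toEuclideanLin A)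

/-- The eigenspace in `ℂ^d` of a complex matrix for one of its eigenvalues. -/
def eigenspace {d : ℕ} (A : Matrix (Fin d) (Fin d) ℂ) (z : Eigenvalue A) :
    Submodule ℂ (Carrier d) :=
  Module.End.eigenspace (Matrix.toEuclideanLin A) (z : ℂ)

/-- The orthogonal projector of `ℂ^d` onto an eigenspace of a complex matrix. -/
def eigenprojector {d : ℕ} (A : Matrix (Fin d) (Fin d) ℂ) (z : Eigenvalue A) :
    Carrier d →L[ℂ] Carrier d :=
  (eigenspace A z).starProjection

end Corep

end

/-! For a Hermitian matrix the degree of the minimal polynomial counts the distinct eigenvalues. Let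
`A` in the Hermitian centralizer have the largest possible count. If an eigenspace of `A` properly
contained an invariant `U ≠ 0`, the orthogonal projector onto `U` would lie in the centralizer too,
because the operators of the action are real-linear isometries
(`starProjection_apply_map_of_norm_map`). Adding a suitable real multiple of it to `A` would split
that eigenspace and create one more eigenvalue, a contradiction.

Maximality is generic (`ae_forall_natDegree_minpoly_le`): degree at least `k` follows from a
nonvanishing `k × k` determinant that is polynomial in the coordinates and nonzero at one real
point, hence at almost every one. The remaining claims are the spectral theorem. -/

/-! ### Real zero sets of complex polynomials -/

namespace MvPolynomial

/-- A nonzero complex polynomial is nonzero at almost every real point. -/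
theorem ae_eval_ofReal_ne_zero : ∀ {n : ℕ} {p : MvPolynomial (Fin n) ℂ}, p ≠ 0 →
    ∀ᵐ x : Fin n → ℝ, eval (fun i => (x i : ℂ)) p ≠ 0
  | 0, p, hp => by
    refine Filter.Eventually.of_forall fun x => ?_
    rw [eq_C_of_isEmpty p, eval_C]
    intro h
    exact hp (by rw [eq_C_of_isEmpty p, h, C_0])
  | n + 1, p, hp => by
    set q := finSuccEquiv ℂ n p with hq
    have hq0 : q ≠ 0 := by simpa [hq] using hp
    have hprod : ∀ᵐ z : ℝ × (Fin n → ℝ),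
        eval (fun i => ((Fin.cons z.1 z.2 : Fin (n + 1) → ℝ) i : ℂ)) p ≠ 0 := by
      have hcont : Continuous fun z : ℝ × (Fin n → ℝ) =>
          eval (fun i => ((Fin.cons z.1 z.2 : Fin (n + 1) → ℝ) i : ℂ)) p := by
        refine (continuous_eval p).comp (continuous_pi fun i => Complex.continuous_ofReal.comp ?_)
        refine Fin.cases ?_ (fun j => ?_) i
        · simpa using continuous_fst
        · simpa [Function.comp_def] using (continuous_apply j).comp continuous_snd
      have hmeas : MeasurableSet {z : ℝ × (Fin n → ℝ) |
          eval (fun i => ((Fin.cons z.1 z.2 : Fin (n + 1) → ℝ) i : ℂ)) p = 0} :=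
        (isClosed_singleton.preimage hcont).measurableSet
      simp only [ae_iff, ne_eq, not_not]
      rw [Measure.volume_eq_prod, Measure.measure_prod_null hmeas]
      -- By Fubini only the slices matter. The slice at `y` is identically zero only if `C y` is a
      -- root of `q`, so for finitely many `y`; induction handles the others.
      have hfin : {y : ℝ | q.eval (C (y : ℂ)) = 0}.Finite := by
        have hinj : Function.Injective fun y : ℝ => (C (y : ℂ) : MvPolynomial (Fin n) ℂ) :=
          (C_injective _ _).comp Complex.ofReal_injective
        refine ((Polynomial.finite_setOfPred_isRoot hq0).preimage hinj.injOn).subset fun y hy => hy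
      filter_upwards [hfin.countable.ae_notMem volume] with y hy
      have h := ae_eval_ofReal_ne_zero (p := q.eval (C (y : ℂ))) hy
      rw [ae_iff] at h
      refine measure_mono_null (fun x hx => ?_) h
      simp only [Set.mem_preimage, Set.mem_ofPred_eq, not_not] at hx ⊢
      rw [← hx, show (fun i => ((Fin.cons y x : Fin (n + 1) → ℝ) i : ℂ)) =
        (Fin.cons (y : ℂ) (fun i => (x i : ℂ)) : Fin (n + 1) → ℂ) by
          ext i; refine Fin.cases ?_ (fun j => ?_) i <;> simp, eval_eq_eval_mv_eval', ← hq]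
      rw [Polynomial.eval_map, ← Polynomial.eval₂_hom (f := eval fun i => (x i : ℂ))]
      simp
    have hmp := (volume_preserving_piFinSuccAbove (fun _ : Fin (n + 1) => ℝ) 0)
    filter_upwards [hmp.quasiMeasurePreserving.ae hprod] with x hx
    have : (Fin.cons (x 0) (fun j => x j.succ) : Fin (n + 1) → ℝ) = x := Fin.cons_self_tail x
    simpa [MeasurableEquiv.piFinSuccAbove, Fin.insertNthEquiv, Fin.removeNth, this] using hx

end MvPolynomial

/-! ### Generic degree of the minimal polynomial -/

section GenericDegree

variable {E : Type*} [Ring E] [Algebra ℂ E] {m : ℕ}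

/-- Every linear functional of a power of a linear pencil is polynomial in the parameters. -/
theorem exists_mvPolynomial_eval_eq_functional_pow (a : Fin m → E) (φ : E →ₗ[ℂ] ℂ) (j : ℕ) :
    ∀ b : E, ∃ p : MvPolynomial (Fin m) ℂ, ∀ x : Fin m → ℂ,
      MvPolynomial.eval x p = φ ((∑ l, x l • a l) ^ j * b) := by
  -- `b` stays quantified: the last factor of the power is expanded and each `a l` absorbed into
  -- `b`.
  induction j with
  | zero => exact fun b => ⟨MvPolynomial.C (φ b), fun x => by simp⟩
  | succ j ih =>
    intro b
    choose p hp using fun l => ih (a l * b)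
    refine ⟨∑ l, MvPolynomial.X l * p l, fun x => ?_⟩
    simp [hp, pow_succ, mul_assoc, Finset.sum_mul, Finset.mul_sum]

/-- A minimal polynomial of degree below `k` would be a nontrivial linear relation among these
powers. -/
theorem le_natDegree_minpoly_of_linearIndependent_pow {x : E} (hx : IsIntegral ℂ x) {k : ℕ}
    (h : LinearIndependent ℂ fun i : Fin k => x ^ (i : ℕ)) : k ≤ (minpoly ℂ x).natDegree := by
  by_contra! hlt
  rw [Fintype.linearIndependent_iff] at h
  have h1 := h (fun i => (minpoly ℂ x).coeff i) (by
    have := minpoly.aeval ℂ x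
    rwa [Polynomial.aeval_eq_sum_range' hlt, ← Fin.sum_univ_eq_sum_range
      (fun i => (minpoly ℂ x).coeff i • x ^ i)] at this) ⟨_, hlt⟩
  exact (minpoly.monic hx).ne_zero (Polynomial.leadingCoeff_eq_zero.1 h1)

/-- If some member of a real linear pencil has minimal polynomial of degree at least `k`, then so
does almost every member. -/
theorem ae_natDegree_minpoly_le [FiniteDimensional ℂ E] (a : Fin m → E) (y : Fin m → ℝ) :
    ∀ᵐ x : Fin m → ℝ, (minpoly ℂ (∑ l, (y l : ℂ) • a l)).natDegree ≤
      (minpoly ℂ (∑ l, (x l : ℂ) • a l)).natDegree := by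
  set k := (minpoly ℂ (∑ l, (y l : ℂ) • a l)).natDegree with hk
  have hli : LinearIndependent ℂ fun i : Fin k => (∑ l, (y l : ℂ) • a l) ^ (i : ℕ) :=
    linearIndependent_pow _
  -- `φ` reads off coordinates along the independent powers at `y`, so the determinant `D` below
  -- takes the value 1 at `y`.
  obtain ⟨φ, hφ⟩ := LinearMap.exists_leftInverse_of_injective
    (Fintype.linearCombination ℂ fun i : Fin k => (∑ l, (y l : ℂ) • a l) ^ (i : ℕ))
    (LinearMap.ker_eq_bot.2 (linearIndependent_iff_injective_fintypeLinearCombination.1 hli))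
  choose p hp using fun i j : Fin k =>
    exists_mvPolynomial_eval_eq_functional_pow a (LinearMap.proj i ∘ₗ φ) j 1
  set D : MvPolynomial (Fin m) ℂ := Matrix.det (Matrix.of p) with hD
  have heval : ∀ x : Fin m → ℂ, MvPolynomial.eval x D =
      Matrix.det (Matrix.of fun i j : Fin k => φ ((∑ l, x l • a l) ^ (j : ℕ)) i) := by
    intro x
    rw [hD, RingHom.map_det]
    congr 1
    ext i j
    simp [hp]
  have hD0 : D ≠ 0 := by
    intro h0
    have h1 := heval fun l => (y l : ℂ)
    have h2 : (Matrix.of fun i j : Fin k => φ ((∑ l, (y l : ℂ) • a l) ^ (j : ℕ)) i) = 1 := by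
      ext i j
      have h3 := congrFun (congrArg (fun f => f (Pi.single j 1)) hφ) i
      simpa [Fintype.linearCombination_apply_single, Matrix.one_apply, Pi.single_apply] using h3
    rw [h2, h0, map_zero, Matrix.det_one] at h1
    exact zero_ne_one h1
  filter_upwards [MvPolynomial.ae_eval_ofReal_ne_zero hD0] with x hx
  rw [heval] at hx
  refine le_natDegree_minpoly_of_linearIndependent_pow (Algebra.IsIntegral.isIntegral _) ?_
  refine LinearIndependent.of_comp φ ?_
  have := Matrix.linearIndependent_rows_of_det_ne_zero (A := (Matrix.of fun i j : Fin k =>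
    φ ((∑ l, (x l : ℂ) • a l) ^ (j : ℕ)) i).transpose) (by rwa [Matrix.det_transpose])
  exact this

/-- Almost every member of a real linear pencil has a minimal polynomial of maximal degree. -/
theorem ae_forall_natDegree_minpoly_le [FiniteDimensional ℂ E] (a : Fin m → E) :
    ∀ᵐ x : Fin m → ℝ, ∀ y : Fin m → ℝ, (minpoly ℂ (∑ l, (y l : ℂ) • a l)).natDegree ≤
      (minpoly ℂ (∑ l, (x l : ℂ) • a l)).natDegree := by
  let f : (Fin m → ℝ) → ℕ := fun y => (minpoly ℂ (∑ l, (y l : ℂ) • a l)).natDegree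
  -- Powers below the degree are independent, so the dimension bounds the degree and the supremum is
  -- attained.
  have hbdd : BddAbove (Set.range f) := ⟨Module.finrank ℂ E, by
    rintro _ ⟨y, rfl⟩
    have := (linearIndependent_pow (K := ℂ) (∑ l, (y l : ℂ) • a l)).fintype_card_le_finrank
    rwa [Fintype.card_fin] at this⟩
  obtain ⟨y, hy⟩ : sSup (Set.range f) ∈ Set.range f := Nat.sSup_mem (Set.range_nonempty f) hbdd
  filter_upwards [ae_natDegree_minpoly_le a y] with x hx y'
  exact (le_csSup hbdd ⟨y', rfl⟩).trans (hy ▸ hx)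

end GenericDegree

/-! ### Real-linear isometries and orthogonal projections -/

section NormPreserving

variable {E : Type*} [NormedAddCommGroup E] [InnerProductSpace ℂ E]

/-- Polarization. Only the real part survives, since `f` may be antilinear. -/
theorem re_inner_map_map_of_norm_map (f : E →ₗ[ℝ] E) (hf : ∀ v, ‖f v‖ = ‖v‖) (v w : E) :
    (inner ℂ (f v) (f w)).re = (inner ℂ v w).re := by
  have h := fun a b : E => re_inner_eq_norm_add_mul_self_sub_norm_mul_self_sub_norm_mul_self_div_two
    (𝕜 := ℂ) a b
  simp only [RCLike.re_to_complex] at h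
  rw [h, h, ← map_add, hf, hf, hf]

/-- A real-linear isometry mapping a finite-dimensional complex subspace into itself commutes with
the orthogonal projection onto the subspace. -/
theorem starProjection_apply_map_of_norm_map (f : E →ₗ[ℝ] E) (hf : ∀ v, ‖f v‖ = ‖v‖)
    (U : Submodule ℂ E) [FiniteDimensional ℂ U] (hU : ∀ v ∈ U, f v ∈ U) (v : E) :
    U.starProjection (f v) = f (U.starProjection v) := by
  have hinj : Function.Injective f := by
    rw [injective_iff_map_eq_zero]
    intro w hw
    rw [← norm_eq_zero, ← hf, hw, norm_zero]
  -- Finite dimension makes `f` map `U` onto itself, so orthogonality to `U` need only be tested on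
  -- images `f w'`.
  have hsurj : ∀ u ∈ U, ∃ u' ∈ U, f u' = u := by
    have : FiniteDimensional ℝ U := FiniteDimensional.complexToReal U
    let g : U.restrictScalars ℝ →ₗ[ℝ] U.restrictScalars ℝ := f.restrict hU
    have hg : Function.Injective g := fun a b hab => Subtype.ext (hinj (congrArg Subtype.val hab))
    have : FiniteDimensional ℝ (U.restrictScalars ℝ) := this
    intro u hu
    obtain ⟨u', hu'⟩ := LinearMap.injective_iff_surjective.1 hg ⟨u, hu⟩
    exact ⟨u', u'.2, congrArg Subtype.val hu'⟩
  refine Submodule.eq_starProjection_of_mem_of_inner_eq_zero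
    (hU _ (Submodule.starProjection_apply_mem U v)) (fun w hw => ?_)
  have hre : ∀ w ∈ U, (inner ℂ (f v - f (U.starProjection v)) w).re = 0 := by
    intro w hw
    obtain ⟨w', hw', rfl⟩ := hsurj w hw
    rw [← map_sub, re_inner_map_map_of_norm_map f hf, Submodule.starProjection_inner_eq_zero _ _ hw',
      Complex.zero_re]
  refine Complex.ext (hre w hw) ?_
  -- The imaginary part is the real part against `I • w`, up to sign.
  have := hre (Complex.I • w) (U.smul_mem _ hw)
  rw [inner_smul_right] at this
  simpa using this

end NormPreserving

/-! ### Splitting eigenspaces of symmetric operators -/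

section Symmetric

open Module.End

variable {E : Type*} [NormedAddCommGroup E] [InnerProductSpace ℂ E] [FiniteDimensional ℂ E]

/-- The minimal polynomial of a symmetric operator has as many roots as its degree. -/
theorem LinearMap.IsSymmetric.card_roots_minpoly {T : E →ₗ[ℂ] E} (hT : T.IsSymmetric) :
    (minpoly ℂ T).roots.toFinset.card = (minpoly ℂ T).natDegree := by
  have hsq : Squarefree (minpoly ℂ T) :=
    (Module.End.isFinitelySemisimple_iff_isSemisimple.1
      hT.isFinitelySemisimple).minpoly_squarefree
  rw [Multiset.toFinset_card_of_nodup (Polynomial.nodup_roots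
    (PerfectField.separable_iff_squarefree.2 hsq)),
    (IsAlgClosed.splits (minpoly ℂ T)).natDegree_eq_card_roots]

/-- Splitting an eigenspace of a symmetric operator by a suitable real multiple of an orthogonal
projection increases the degree of the minimal polynomial. -/
theorem LinearMap.IsSymmetric.exists_natDegree_minpoly_lt_add_smul_starProjection
    {T : E →ₗ[ℂ] E} (hT : T.IsSymmetric) {z : ℂ} {U : Submodule ℂ E} (hU : U < eigenspace T z)
    (hU0 : U ≠ ⊥) :
    ∃ ε : ℝ, (minpoly ℂ T).natDegree <
      (minpoly ℂ (T + (ε : ℂ) • (U.starProjection : E →ₗ[ℂ] E))).natDegree := by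
  have hT0 : minpoly ℂ T ≠ 0 := minpoly.ne_zero (Algebra.IsIntegral.isIntegral T)
  -- `z + ε` will be the eigenvalue on `U`; avoiding the finitely many eigenvalues of `T` makes it
  -- new.
  obtain ⟨ε, hε⟩ : ∃ ε : ℝ, z + ε ∉ (minpoly ℂ T).roots.toFinset := by
    have hinj : Function.Injective fun ε : ℝ => z + (ε : ℂ) :=
      (add_right_injective z).comp Complex.ofReal_injective
    exact ((minpoly ℂ T).roots.toFinset.finite_toSet.preimage hinj.injOn).exists_notMem
  refine ⟨ε, ?_⟩
  set T' := T + (ε : ℂ) • (U.starProjection : E →ₗ[ℂ] E) with hT'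
  have hT'0 : minpoly ℂ T' ≠ 0 := minpoly.ne_zero (Algebra.IsIntegral.isIntegral T')
  have happ : ∀ v, T' v = T v + (ε : ℂ) • U.starProjection v := fun v => rfl
  have hkeep : ∀ {μ : ℂ} {v : E}, T v = μ • v → v ∈ Uᗮ → v ≠ 0 → HasEigenvalue T' μ := by
    intro μ v hv hvU hv0
    refine hasEigenvalue_of_hasEigenvector (x := v) ⟨mem_eigenspace_iff.2 ?_, hv0⟩
    rw [happ, hv, (Submodule.starProjection_apply_eq_zero_iff U).2 hvU, smul_zero, add_zero]
  have hmem : ∀ μ, μ ∈ (minpoly ℂ T).roots.toFinset ↔ HasEigenvalue T μ := fun μ => by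
    rw [Multiset.mem_toFinset, Polynomial.mem_roots hT0, hasEigenvalue_iff_isRoot]
  have hmem' : ∀ μ, μ ∈ (minpoly ℂ T').roots.toFinset ↔ HasEigenvalue T' μ := fun μ => by
    rw [Multiset.mem_toFinset, Polynomial.mem_roots hT'0, hasEigenvalue_iff_isRoot]
  have hnew : HasEigenvalue T' (z + ε) := by
    obtain ⟨u, hu, hu0⟩ := Submodule.exists_mem_ne_zero_of_ne_bot hU0
    refine hasEigenvalue_of_hasEigenvector (x := u) ⟨mem_eigenspace_iff.2 ?_, hu0⟩
    rw [happ, mem_eigenspace_iff.1 (hU.le hu), Submodule.starProjection_eq_self_iff.2 hu, add_smul]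
  rw [← hT.card_roots_minpoly]
  refine (Finset.card_lt_card ((Finset.ssubset_iff_of_subset fun μ hμ => ?_).2
    ⟨z + ε, (hmem' _).2 hnew, hε⟩)).trans_le
    ((Multiset.toFinset_card_le _).trans (Polynomial.card_roots' _))
  rw [hmem] at hμ
  rw [hmem']
  -- No old eigenvalue is lost: `z` survives on the part of its eigenspace orthogonal to `U`, and
  -- the other eigenspaces are orthogonal to `U` altogether.
  by_cases hμz : μ = z
  · subst hμz
    obtain ⟨v, hv, hvU⟩ := SetLike.exists_of_lt hU
    have hP : U.starProjection v ∈ U := Submodule.starProjection_apply_mem U v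
    refine hkeep (v := v - U.starProjection v) ?_
      (Submodule.sub_starProjection_mem_orthogonal v) ?_
    · exact mem_eigenspace_iff.1 (Submodule.sub_mem _ hv (hU.le hP))
    · intro h
      rw [sub_eq_zero] at h
      exact hvU (h ▸ hP)
  · obtain ⟨v, hv⟩ := hμ.exists_hasEigenvector
    refine hkeep hv.apply_eq_smul ((Submodule.mem_orthogonal _ _).2 fun u hu => ?_) hv.2
    exact hT.orthogonalFamily_eigenspaces (Ne.symm hμz) ⟨u, hU.le hu⟩ ⟨v, hv.1⟩

end Symmetric

/-! ### The Hermitian centralizer and its generic elements -/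

namespace Corep

theorem norm_kappa (d : ℕ) (ε : ℤˣ) (v : Carrier d) : ‖kappa d ε v‖ = ‖v‖ := by
  unfold kappa
  split_ifs
  · rfl
  · simp [conjugation, EuclideanSpace.norm_eq]

theorem norm_matOp_of_mem_unitaryGroup {d : ℕ} {A : Matrix (Fin d) (Fin d) ℂ}
    (hA : A ∈ Matrix.unitaryGroup (Fin d) ℂ) (v : Carrier d) : ‖matOp A v‖ = ‖v‖ :=
  ContinuousLinearMap.norm_map_of_mem_unitary
    (Unitary.map_mem (Matrix.toEuclideanCLM (n := Fin d) (𝕜 := ℂ)) hA) v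

namespace ProjCorep

variable {G : Type*} [Group G] {s : G →* ℤˣ} {ω : FactorSystem s} {d : ℕ}

theorem norm_op (R : ProjCorep s ω d) (g : G) (v : Carrier d) : ‖R.op g v‖ = ‖v‖ :=
  (norm_matOp_of_mem_unitaryGroup (R.M g).2 _).trans (norm_kappa d (s g) v)

theorem IsInvariant.starProjection_op {R : ProjCorep s ω d} {U : Submodule ℂ (Carrier d)}
    (hU : R.IsInvariant U) (g : G) (v : Carrier d) :
    U.starProjection (R.op g v) = R.op g (U.starProjection v) :=
  starProjection_apply_map_of_norm_map (R.op g) (R.norm_op g) U (hU g) v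

/-- The matrix of the orthogonal projection onto an invariant subspace is a Hermitian matrix
commuting with the action. -/
theorem IsInvariant.symm_starProjection_mem {R : ProjCorep s ω d} {U : Submodule ℂ (Carrier d)}
    (hU : R.IsInvariant U) :
    Matrix.toEuclideanLin.symm (U.starProjection : Carrier d →ₗ[ℂ] Carrier d) ∈
      R.hermitianCentralizer := by
  refine ⟨Matrix.isSymmetric_toEuclideanLin_iff.1 ?_, fun g => LinearMap.ext fun v => ?_⟩
  · rw [LinearEquiv.apply_symm_apply]
    exact U.starProjection_isSymmetric
  · simp only [matOp, LinearEquiv.apply_symm_apply]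
    exact hU.starProjection_op g v

/-- Eigenvalues of a Hermitian matrix are real, so they pass through antilinear operators
unconjugated. -/
theorem isInvariant_eigenspace {R : ProjCorep s ω d} {A : Matrix (Fin d) (Fin d) ℂ}
    (hA : A ∈ R.hermitianCentralizer) (z : Eigenvalue A) : R.IsInvariant (eigenspace A z) := by
  intro g v hv
  have hz : ((z : ℂ).re : ℂ) = z := Complex.conj_eq_iff_re.1
    ((Matrix.isSymmetric_toEuclideanLin_iff.2 hA.1).conj_eigenvalue_eq_self z.2)
  have hv' : matOp A v = (z : ℂ).re • v := by
    rw [← Complex.coe_smul, hz]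
    exact Module.End.mem_eigenspace_iff.1 hv
  refine Module.End.mem_eigenspace_iff.2 ?_
  have h := LinearMap.congr_fun (hA.2 g) v
  simp only [LinearMap.comp_apply, hv', map_smul] at h
  rw [← Complex.coe_smul, hz] at h
  exact h

/-- If the minimal polynomial of a Hermitian matrix commuting with the action has maximal degree,
then its eigenspaces are irreducible components. -/
theorem isIrreducibleComponent_eigenspace {R : ProjCorep s ω d} {A : Matrix (Fin d) (Fin d) ℂ}
    (hA : A ∈ R.hermitianCentralizer)
    (hmax : ∀ B ∈ R.hermitianCentralizer, (minpoly ℂ (Matrix.toEuclideanLin B)).natDegree ≤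
      (minpoly ℂ (Matrix.toEuclideanLin A)).natDegree) (z : Eigenvalue A) :
    R.IsIrreducibleComponent (eigenspace A z) := by
  refine ⟨z.2, isInvariant_eigenspace hA z, fun U hUW hU => ?_⟩
  by_contra! hne
  obtain ⟨ε, hε⟩ := (Matrix.isSymmetric_toEuclideanLin_iff.2
    hA.1).exists_natDegree_minpoly_lt_add_smul_starProjection (lt_of_le_of_ne hUW hne.2) hne.1
  have h := hmax _ (add_mem hA (Submodule.smul_mem _ ε hU.symm_starProjection_mem))
  rw [map_add, ← Complex.coe_smul, map_smul, LinearEquiv.apply_symm_apply] at h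
  exact hε.not_ge h

/-- For almost every coefficient vector, the minimal polynomial of the corresponding element of the
Hermitian centralizer has maximal degree. -/
theorem ae_forall_mem_natDegree_minpoly_le (R : ProjCorep s ω d) {m : ℕ}
    (Q : Module.Basis (Fin m) ℝ R.hermitianCentralizer) :
    ∀ᵐ x : Fin m → ℝ, ∀ B ∈ R.hermitianCentralizer,
      (minpoly ℂ (Matrix.toEuclideanLin B)).natDegree ≤
      (minpoly ℂ (Matrix.toEuclideanLin
        (∑ l, x l • (Q l : Matrix (Fin d) (Fin d) ℂ)))).natDegree := by
  have hlin : ∀ x : Fin m → ℝ,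
      Matrix.toEuclideanLin (∑ l, x l • (Q l : Matrix (Fin d) (Fin d) ℂ)) =
        ∑ l, (x l : ℂ) • Matrix.toEuclideanLin (Q l : Matrix (Fin d) (Fin d) ℂ) := by
    intro x
    simp only [← Complex.coe_smul, map_sum, map_smul]
  filter_upwards [ae_forall_natDegree_minpoly_le
    fun l => Matrix.toEuclideanLin (Q l : Matrix (Fin d) (Fin d) ℂ)] with x hx B hB
  have hB' : ∑ l, Q.repr ⟨B, hB⟩ l • (Q l : Matrix (Fin d) (Fin d) ℂ) = B := by
    have h := congrArg R.hermitianCentralizer.subtype (Q.sum_repr ⟨B, hB⟩)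
    rw [map_sum] at h
    exact h
  rw [hlin, ← hB', hlin]
  exact hx _

end ProjCorep

end Corep

theorem mainTheorem2 {G : Type*} [Group G] (s : G →* ℤˣ) (ω : Corep.FactorSystem s) (d : ℕ)
    (R : Corep.ProjCorep s ω d)
    (m : ℕ) (Q : Module.Basis (Fin m) ℝ R.hermitianCentralizer)
    {Ω : Type*} [MeasurableSpace Ω] (P : Measure Ω) [IsProbabilityMeasure P]
    (r : Fin m → Ω → ℝ) (hr : ∀ l, Measurable (r l))
    (hlaw : P.map (fun x l => r l x) ≪ (volume : Measure (Fin m → ℝ))) :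
    ∀ᵐ x ∂P, ∀ A : Matrix (Fin d) (Fin d) ℂ,
      A = ∑ l, r l x • (Q l : Matrix (Fin d) (Fin d) ℂ) →
        -- the space is the internal, orthogonal direct sum of the eigenspaces
        DirectSum.IsInternal (fun z : Corep.Eigenvalue A => Corep.eigenspace A z) ∧
        (∀ z z' : Corep.Eigenvalue A, z ≠ z' → Corep.eigenspace A z ⟂ Corep.eigenspace A z') ∧
        -- each eigenspace is an irreducible component
        (∀ z : Corep.Eigenvalue A, R.IsIrreducibleComponent (Corep.eigenspace A z)) ∧
        -- the eigenprojectors are a resolution of the identity commuting with the action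
        (∑ z : Corep.Eigenvalue A, Corep.eigenprojector A z = 1) ∧
        (∀ z z' : Corep.Eigenvalue A, z ≠ z' →
          Corep.eigenprojector A z * Corep.eigenprojector A z' = 0) ∧
        (∀ (z : Corep.Eigenvalue A) (g : G) (v : Corep.Carrier d),
          Corep.eigenprojector A z (R.op g v) = R.op g (Corep.eigenprojector A z v)) := by
  -- Absolute continuity of the law turns the Lebesgue-null exceptional set into a `P`-null event.
  filter_upwards [ae_of_ae_map (measurable_pi_lambda _ hr).aemeasurable
    (hlaw.ae_le (R.ae_forall_mem_natDegree_minpoly_le Q))] with x hx A hAx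
  rw [← hAx] at hx
  have hA : A ∈ R.hermitianCentralizer := by
    rw [hAx]
    exact sum_mem fun l _ => Submodule.smul_mem _ _ (Q l).2
  have hsymm := Matrix.isSymmetric_toEuclideanLin_iff.2 hA.1
  have hint : DirectSum.IsInternal fun z : Corep.Eigenvalue A => Corep.eigenspace A z :=
    hsymm.direct_sum_isInternal
  have horth : ∀ z z' : Corep.Eigenvalue A, z ≠ z' →
      Corep.eigenspace A z ⟂ Corep.eigenspace A z' := fun z z' h =>
    hsymm.orthogonalFamily_eigenspaces'.isOrtho h
  refine ⟨hint, horth, Corep.ProjCorep.isIrreducibleComponent_eigenspace hA hx, ?_,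
    fun z z' h => (horth z z' h).starProjection_comp_starProjection,
    fun z => (Corep.ProjCorep.isInvariant_eigenspace hA z).starProjection_op⟩
  ext1 v
  rw [sum_apply]
  exact hsymm.orthogonalFamily_eigenspaces'.sum_projection_of_mem_iSup v
    (hint.submodule_iSup_eq_top ▸ Submodule.mem_top)
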